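/- A $k$-tape quantum Turing machine (QTM) $M$ has a finite set $Q$ of internal states with an initial state $q_0$ and a set $Q_f\subseteq Q$ of final states, two-way infinite tapes $1,\dots,k$ with finite alphabets $\Sigma_1,\dots,\Sigma_k$, each containing a blank symbol, and amplitudes $\delta(p,\boldsymbol\sigma,q,\boldsymbol\tau,\boldsymbol d)\in\mathbb C$ for all $p,q\in Q$, $\boldsymbol\sigma,\boldsymbol\tau\in\Sigma_1\times\cdots\times\Sigma_k$ and $\boldsymbol d\in\{R,N,L\}^k$ (each head steps right, stays, or steps left). A configuration consists of a state, the tape contents (only finitely many cells non-blank) and the head positions; it is final if its state lies in $Q_f$. The time-evolution operator is the linear map on finite complex linear combinations of configurations (superpositions) induced by $\delta$, and $M$ is well-formed if this operator preserves the $L_2$-norm. Inputs are $k$-tuples $\boldsymbol x$ of strings of non-blank symbols; in the initial configuration on $\boldsymbol x$ the state is $q_0$, the strings are written from the start cells (cells $0$) to the right, and all heads are on the start cells. A computation path on $\boldsymbol x$ is an infinite sequence of configurations that starts with the initial one and in which every step has non-zero amplitude. The machine halts in time $t$ on $\boldsymbol x$ if $t$ is the least time at which all computation paths on $\boldsymbol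 x$ are in final configurations; the superposition at that time is the final superposition $M(|\boldsymbol x\rangle)$. The machine is synchronous if, on every input, any two computation paths reach a final configuration for the first time at the same time (possibly never). For a fixed output tape and a fixed accepting symbol, the acceptance probability $\mu_M(\boldsymbol x)$ is the probability of observing that symbol in the start cell of the output tape in $M(|\boldsymbol x\rangle)$. Let $M$ be a well-formed $k$-tape QTM that halts in time $T(\boldsymbol x)$ on every input $\boldsymbol x$. Then: 1. There is a $(k+2)$-tape, well-formed, synchronous QTM $M'$ with exactly one final state, whose first $k$ tapes have the same alphabets as those of $M$ and whose tape $k+1$ has a non-blank symbol $1$, such that for every input $\boldsymbol x$ of $M$, on input $(\boldsymbol x,1^{T(\boldsymbol x)})$ (with $\boldsymbol x$ on tapes $1,\dots,k$, $1^{T(\boldsymbol x)}$ on tape $k+1$, and tape $k+2$ empty): $M'$ halts in time $2T(\boldsymbol x)+2$; at that time, on every computation path, the last two heads are on their start cells and the content of tape $k+1$ is $1^{T(\boldsymbol x)}$; and $\mu_{M'}(\boldsymbol x,1^{T(\boldsymbol x)})=\mu_M(\boldsymbol x)$, for every choice of the output tape among tapes $1,\dots,k$ and of the accepting symbol (the same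 for $M$ and $M'$). 2. If moreover $M$ has exactly one final state $q_f$, then there is such an $M'$ with only $k+1$ tapes (tape $k+2$ being omitted, and the last head, that of tape $k+1$, being on its start cell at time $2T(\boldsymbol x)+2$), and it can be chosen so that in addition, for every input $\boldsymbol x$, $$M'(|\boldsymbol x,1^{T(\boldsymbol x)}\rangle)=\tilde M_{T,1}(|\boldsymbol x,1^{T(\boldsymbol x)}\rangle).$$ Here $\tilde M_{T,1}$ is the $(k+1)$-tape QTM that acts as $M$ on tapes $1,\dots,k$ while leaving tape $k+1$ unchanged with its head idle, tape $k+1$ having the same alphabet as in $M'$; the states of $M$ are identified with states of $M'$ by an injection that sends $q_f$ to the final state of $M'$. -/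

import Mathlib

/-- Head moves: right, no move, left. -/
inductive QTM.Dir where
  | R | N | L
  deriving DecidableEq

instance : Fintype QTM.Dir where
  elems := {.R, .N, .L}
  complete := fun d => by cases d <;> simp

/-- The displacement of a head (cells are indexed by `ℤ`, increasing to the right). -/
def QTM.Dir.shift : QTM.Dir → ℤ
  | .R => 1
  | .N => 0
  | .L => -1

/-- A finite tape alphabet with a distinguished blank symbol. -/
structure QTM.Alphabet where
  Sym : Type
  [fintypeSym : Fintype Sym]
  [decidableEqSym : DecidableEq Sym]
  blank : Sym

attribute [instance] QTM.Alphabet.fintypeSym QTM.Alphabet.decidableEqSym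

/-- The non-blank symbols; input strings are strings of these. -/
abbrev QTM.Alphabet.NonBlank (Γ : QTM.Alphabet) : Type := {a : Γ.Sym // a ≠ Γ.blank}

/-- A quantum Turing machine whose tapes are indexed by `ι`, tape `i` having alphabet `A i`.
A `k`-tape machine has `ι = Fin k`; a `(k+m)`-tape machine has `ι = Fin k ⊕ Fin m`, the tapes
`Sum.inl i` being the first `k` and the tapes `Sum.inr j` the last `m`.
`δ p σ (q, τ, d)` is the amplitude with which the machine, in state `p` and scanning `σ`,
writes `τ`, moves the heads by `d` and enters state `q`. -/
structure QTM (ι : Type) (A : ι → QTM.Alphabet) where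
  Q : Type
  [fintypeQ : Fintype Q]
  [decidableEqQ : DecidableEq Q]
  /-- initial state -/
  q₀ : Q
  /-- set of final states -/
  final : Set Q
  δ : Q → (∀ i, (A i).Sym) → Q × (∀ i, (A i).Sym) × (ι → QTM.Dir) → ℂ

attribute [instance] QTM.fintypeQ QTM.decidableEqQ

namespace QTM

/-- Configurations: internal state, contents of the two-way infinite tapes (all but finitely
many cells blank), and head positions. -/
@[ext]
structure Config (Q : Type) {ι : Type} (A : ι → Alphabet) where
  state : Q
  tape : ∀ i, ℤ → (A i).Sym
  head : ι → ℤ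
  finite_nonblank : ∀ i, {z | tape i z ≠ (A i).blank}.Finite

/-- A tuple of input strings, one for each tape. -/
abbrev Input {ι : Type} (A : ι → Alphabet) : Type := ∀ i, List (A i).NonBlank

/-- The tape on which `w` is written in the cells `0, 1, …, |w| - 1`, all other cells blank. -/
def inputTape {Γ : Alphabet} (w : List Γ.NonBlank) (z : ℤ) : Γ.Sym :=
  if 0 ≤ z then (w[z.toNat]?.map Subtype.val).getD Γ.blank else Γ.blank

theorem inputTape_finite {Γ : Alphabet} (w : List Γ.NonBlank) :
    {z | inputTape w z ≠ Γ.blank}.Finite := by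
  refine (Set.finite_Icc (0 : ℤ) w.length).subset fun z hz => ?_
  by_contra hc
  apply hz
  unfold inputTape
  split_ifs with h
  · have : w.length ≤ z.toNat := by
      simp only [Set.mem_Icc, not_and, not_le] at hc
      have := hc h
      omega
    simp [List.getElem?_eq_none this]
  · rfl

/-- Relabel the internal state of a configuration. -/
def Config.mapState {Q Q' ι : Type} {A : ι → Alphabet} (e : Q → Q') (c : Config Q A) :
    Config Q' A where
  state := e c.state
  tape := c.tape
  head := c.head
  finite_nonblank := c.finite_nonblank

/-- The configuration after writing `τ` in the scanned cells, moving the heads by `d` and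
entering state `q`. -/
def Config.update {Q ι : Type} {A : ι → Alphabet} (c : Config Q A)
    (q : Q) (τ : ∀ i, (A i).Sym) (d : ι → Dir) : Config Q A where
  state := q
  tape := fun i => Function.update (c.tape i) (c.head i) (τ i)
  head := fun i => c.head i + (d i).shift
  finite_nonblank := fun i => by
    refine ((c.finite_nonblank i).insert (c.head i)).subset fun z hz => ?_
    by_cases h : z = c.head i
    · exact Or.inl h
    · refine Or.inr ?_
      simpa [Function.update_of_ne h] using hz

/-- The symbols scanned by the heads. -/
def Config.scanned {Q ι : Type} {A : ι → Alphabet} (c : Config Q A) (i : ι) : (A i).Sym :=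
  c.tape i (c.head i)

/-- Superpositions: finite complex linear combinations of configurations. -/
abbrev Superposition (Q : Type) {ι : Type} (A : ι → Alphabet) : Type := Config Q A →₀ ℂ

/-- The `L₂`-norm of a superposition. -/
noncomputable def l2norm {Q ι : Type} {A : ι → Alphabet} (φ : Superposition Q A) : ℝ :=
  Real.sqrt (φ.sum fun _ a => ‖a‖ ^ 2)

section Machine

variable {ι : Type} [Fintype ι] [DecidableEq ι] {A : ι → Alphabet}

/-- The initial configuration: initial state, inputs written from the start cells (cells `0`)
to the right, heads on the start cells. -/
def init (M : QTM ι A) (x : Input A) : Config M.Q A where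
  state := M.q₀
  tape := fun i => inputTape (x i)
  head := fun _ => 0
  finite_nonblank := fun i => inputTape_finite (x i)

/-- One step of the machine from a configuration. -/
noncomputable def stepConfig (M : QTM ι A) (c : Config M.Q A) : Superposition M.Q A :=
  ∑ r : M.Q × (∀ i, (A i).Sym) × (ι → Dir),
    Finsupp.single (c.update r.1 r.2.1 r.2.2) (M.δ c.state c.scanned r)

/-- The time-evolution operator: the linear extension of `stepConfig`. -/
noncomputable def evolution (M : QTM ι A) : Superposition M.Q A →ₗ[ℂ] Superposition M.Q A :=
  Finsupp.linearCombination ℂ M.stepConfig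

/-- A machine is well-formed if its time-evolution operator preserves the `L₂`-norm. -/
def WellFormed (M : QTM ι A) : Prop :=
  ∀ φ : Superposition M.Q A, l2norm (M.evolution φ) = l2norm φ

/-- `γ` is a computation path on input `x`: it starts in the initial configuration, and each
step has nonzero amplitude. -/
def IsPath (M : QTM ι A) (x : Input A) (γ : ℕ → Config M.Q A) : Prop :=
  γ 0 = M.init x ∧ ∀ t, M.stepConfig (γ t) (γ (t + 1)) ≠ 0

/-- A final configuration is one whose state is final. -/
def IsFinal (M : QTM ι A) (c : Config M.Q A) : Prop := c.state ∈ M.final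

/-- The times at which all computation paths on input `x` are in final configurations. -/
def haltingTimes (M : QTM ι A) (x : Input A) : Set ℕ :=
  {t | ∀ γ, M.IsPath x γ → M.IsFinal (γ t)}

/-- `M` on input `x` halts in time `t`: the running time exists and equals `t`. -/
def HaltsIn (M : QTM ι A) (x : Input A) (t : ℕ) : Prop := IsLeast (M.haltingTimes x) t

/-- The running time of `M` on `x` (meaningful only if `M` halts on `x`). -/
noncomputable def time (M : QTM ι A) (x : Input A) : ℕ := sInf (M.haltingTimes x)

/-- The path `γ` reaches a final configuration (for the first time) at time `t`. -/
def ReachesFinalAt (M : QTM ι A) (γ : ℕ → Config M.Q A) (t : ℕ) : Prop :=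
  IsLeast {s | M.IsFinal (γ s)} t

/-- A machine is synchronous if, on every input, any two computation paths reach final
configurations at the same time. -/
def Synchronous (M : QTM ι A) : Prop :=
  ∀ (x : Input A) (γ γ' : ℕ → Config M.Q A), M.IsPath x γ → M.IsPath x γ' →
    ∀ t, M.ReachesFinalAt γ t ↔ M.ReachesFinalAt γ' t

/-- A machine with exactly one final state. -/
def SingleFinal (M : QTM ι A) : Prop := ∃ q, M.final = {q}

/-- The final superposition on input `x`: the superposition at the running time. -/
noncomputable def finalSuperposition (M : QTM ι A) (x : Input A) : Superposition M.Q A :=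
  (M.evolution ^ M.time x) (Finsupp.single (M.init x) 1)

/-- The acceptance probability on input `x`, for output tape `o` and accepting symbol `s`: the
probability of observing `s` in the start cell of tape `o` in the final superposition. -/
noncomputable def acceptProb (M : QTM ι A) (o : ι) (s : (A o).Sym) (x : Input A) : ℝ :=
  (M.finalSuperposition x).sum fun c a => if c.tape o 0 = s then ‖a‖ ^ 2 else 0

/-- The machine with additional tapes (indexed by `κ`, with alphabets `B`) that behaves like
`M` on the old tapes, while the additional tapes are left unchanged and their heads idle. -/
noncomputable def idle (M : QTM ι A) {κ : Type} [Fintype κ] [DecidableEq κ]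
    (B : κ → Alphabet) : QTM (ι ⊕ κ) (Sum.elim A B) where
  Q := M.Q
  q₀ := M.q₀
  final := M.final
  δ := fun p σ r =>
    if ∀ j : κ, r.2.1 (Sum.inr j) = σ (Sum.inr j) ∧ r.2.2 (Sum.inr j) = Dir.N then
      M.δ p (fun i => σ (Sum.inl i))
        (r.1, (fun i => r.2.1 (Sum.inl i)), fun i => r.2.2 (Sum.inl i))
    else 0

end Machine

/-- The input `(x, 1ⁿ)` (with symbol `one` for `1`): `x` on the old tapes, `1ⁿ` on the first
additional tape, and the remaining additional tapes empty. -/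
def clockInput {ι : Type} {A : ι → Alphabet} {m : ℕ} {B : Fin (m + 1) → Alphabet}
    (one : (B 0).NonBlank) (x : Input A) (n : ℕ) : Input (Sum.elim A B) :=
  fun i => match i with
    | Sum.inl i => x i
    | Sum.inr j =>
        Fin.cons (α := fun j => List (B j).NonBlank) (List.replicate n one) (fun _ => []) j

end QTM

/-! The machine `M` is driven by a clock whose heads move in lockstep over the extra tapes. While
the clock scans ones it moves right and `M` makes one step per cell. After `n` leading ones `M` is
frozen, the clock turns around and sweeps back to cell `-1`. There the state of `M` is exchanged
with a stored symbol, and a last move right puts the heads on cell `0` in the single final state.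
This takes `n + 1 + n + 1 = 2n + 2` steps, whatever `M` does, so the machine is synchronous on every
input (`reachesFinalAt_clocked`).

The exchange is what allows a unique final state without losing reversibility: the information in
the state of `M` is moved to the register. The register symbols are states of `M`, and the blank is
the state `z` that ends up in the final state. With a separate register tape `z` is arbitrary and
the clock tape is untouched. If `M` has the single final state `z`, the exchange at time `T` swaps
`z` with `z` and changes nothing, so the clock tape can serve as its own register.

A step is an isometry on the configurations of `M`, controlled by the clock configuration, followed
by an injective relabelling of configurations. This gives well-formedness (`clockStep_injective`,
`normSq_controlled`). The same factorization shows that the final superposition is that of `M`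
pushed forward along the injective map `clockEnd`, which preserves the tapes of `M` and hence all
acceptance probabilities. -/

namespace QTM

set_option linter.unusedSectionVars false

/-! ### Configurations on a disjoint union of tapes -/

section Join

variable {Q P S ι κ : Type} {A : ι → Alphabet} {B : κ → Alphabet}

/-- The tuple of symbols on the tapes `ι ⊕ κ` with given components. -/
def pairSym (σ : ∀ i, (A i).Sym) (b : ∀ j, (B j).Sym) : ∀ i, (Sum.elim A B i).Sym
  | .inl i => σ i
  | .inr j => b j

/-- The configuration in state `s` whose tapes are those of `c` and of `w`. -/
def joinWith (s : S) (c : Config Q A) (w : Config P B) : Config S (Sum.elim A B) where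
  state := s
  tape
    | .inl i => c.tape i
    | .inr j => w.tape j
  head := Sum.elim c.head w.head
  finite_nonblank
    | .inl i => c.finite_nonblank i
    | .inr j => w.finite_nonblank j

/-- The configuration made of a configuration on the tapes `ι` and one on the tapes `κ`. -/
def join (c : Config Q A) (w : Config P B) : Config (Q × P) (Sum.elim A B) :=
  joinWith (c.state, w.state) c w

theorem joinWith_inj {s s' : S} {c c' : Config Q A} {w w' : Config P B}
    (h : joinWith s c w = joinWith s' c' w') :
    s = s' ∧ c.tape = c'.tape ∧ c.head = c'.head ∧ w.tape = w'.tape ∧ w.head = w'.head := by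
  have ht := congrArg Config.tape h
  have hh := congrArg Config.head h
  exact ⟨congrArg Config.state h, funext fun i => congrFun ht (.inl i),
    funext fun i => congrFun hh (.inl i), funext fun j => congrFun ht (.inr j),
    funext fun j => congrFun hh (.inr j)⟩

/-- The part of a configuration on the tapes `ι`. -/
def leftPart (d : Config (Q × P) (Sum.elim A B)) : Config Q A where
  state := d.state.1
  tape i := d.tape (.inl i)
  head i := d.head (.inl i)
  finite_nonblank i := d.finite_nonblank (.inl i)

/-- The part of a configuration on the tapes `κ`. -/
def rightPart (d : Config (Q × P) (Sum.elim A B)) : Config P B where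
  state := d.state.2
  tape j := d.tape (.inr j)
  head j := d.head (.inr j)
  finite_nonblank j := d.finite_nonblank (.inr j)

theorem join_parts (d : Config (Q × P) (Sum.elim A B)) : join (leftPart d) (rightPart d) = d := by
  refine Config.ext rfl (funext fun i => ?_) (funext fun i => ?_) <;> cases i <;> rfl

variable (Q P A B) in
/-- Configurations on the tapes `ι ⊕ κ` as pairs. -/
def joinEquiv : Config P B × Config Q A ≃ Config (Q × P) (Sum.elim A B) where
  toFun x := join x.2 x.1
  invFun d := (rightPart d, leftPart d)
  left_inv _ := rfl
  right_inv := join_parts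

theorem Config.update_self (c : Config Q A) :
    c.update c.state c.scanned (fun _ => Dir.N) = c := by
  refine Config.ext rfl (funext fun i => ?_) (funext fun i => ?_)
  · exact Function.update_eq_self _ _
  · exact add_zero _

theorem joinWith_update [DecidableEq ι] [DecidableEq κ] (s t : S)
    (c : Config Q A) (w : Config P B) (q : Q) (p : P) (τ : ∀ i, (A i).Sym) (b : ∀ j, (B j).Sym)
    (d : ι → Dir) (e : κ → Dir) :
    (joinWith s c w).update t (pairSym τ b) (Sum.elim d e) =
      joinWith t (c.update q τ d) (w.update p b e) := by
  refine Config.ext rfl (funext fun i => ?_) (funext fun i => ?_) <;> cases i <;> rfl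

end Join

/-! ### Norms and controlled isometries -/

section Norm

variable {Q ι : Type} {A : ι → Alphabet}

/-- The squared norm of a finitely supported function. -/
noncomputable def normSq {X : Type} (φ : X →₀ ℂ) : ℝ := φ.sum fun _ a => ‖a‖ ^ 2

theorem l2norm_eq_iff (φ ψ : Superposition Q A) : l2norm φ = l2norm ψ ↔ normSq φ = normSq ψ := by
  unfold l2norm normSq
  exact Real.sqrt_inj (Finset.sum_nonneg fun _ _ => sq_nonneg _)
    (Finset.sum_nonneg fun _ _ => sq_nonneg _)

theorem normSq_mapDomain {X Y : Type} {f : X → Y} (hf : Function.Injective f) (φ : X →₀ ℂ) :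
    normSq (φ.mapDomain f) = normSq φ :=
  Finsupp.sum_mapDomain_index_inj hf

/-- Vectors placed over distinct register values have disjoint supports, so their squared norms add.
-/
theorem normSq_sum_fibers {W X : Type} (ψ : W → X →₀ ℂ) (s : Finset W) :
    normSq (∑ w ∈ s, (ψ w).mapDomain (Prod.mk w)) = ∑ w ∈ s, normSq (ψ w) := by
  classical
  induction s using Finset.induction_on with
  | empty => simp [normSq]
  | insert w s hw ih =>
    rw [Finset.sum_insert hw, Finset.sum_insert hw, ← ih,
      ← normSq_mapDomain (Prod.mk_right_injective w) (ψ w)]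
    refine Finsupp.sum_add_index_of_disjoint (Finset.disjoint_left.mpr fun x hx hx' => ?_) _
    obtain ⟨y, -, rfl⟩ := Finset.mem_image.mp (Finsupp.mapDomain_support hx)
    obtain ⟨v, hv, hx''⟩ := Finset.mem_biUnion.mp (Finsupp.support_finsetSum hx')
    obtain ⟨z, -, hz⟩ := Finset.mem_image.mp (Finsupp.mapDomain_support hx'')
    exact hw ((Prod.mk.inj hz).1 ▸ hv)

theorem eq_sum_fibers {W X : Type} (φ : W × X →₀ ℂ) :
    φ = ∑ w ∈ φ.curry.support, (φ.curry w).mapDomain (Prod.mk w) := by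
  classical
  ext ⟨w, x⟩
  rw [Finsupp.finsetSum_apply, Finset.sum_eq_single w]
  · rw [Finsupp.mapDomain_apply (Prod.mk_right_injective w), Finsupp.curry_apply]
  · intro v _ hv
    refine Finsupp.mapDomain_of_notMem_range _ _ ?_
    rintro ⟨y, hy⟩
    exact hv (Prod.mk.inj hy).1
  · intro h
    rw [Finsupp.notMem_support_iff.mp h]
    simp

/-- A family of isometries, controlled by a register, is an isometry. -/
theorem normSq_controlled {W X : Type} (U : W → (X →₀ ℂ) →ₗ[ℂ] (X →₀ ℂ))
    (hU : ∀ w φ, normSq (U w φ) = normSq φ) (V : (W × X →₀ ℂ) →ₗ[ℂ] (W × X →₀ ℂ))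
    (hV : ∀ w φ, V (φ.mapDomain (Prod.mk w)) = (U w φ).mapDomain (Prod.mk w))
    (φ : W × X →₀ ℂ) : normSq (V φ) = normSq φ := by
  rw [eq_sum_fibers φ, map_sum]
  simp only [hV]
  rw [normSq_sum_fibers (fun w => U w (φ.curry w)), normSq_sum_fibers (fun w => φ.curry w)]
  simp only [hU]

end Norm

/-! ### Reachability, paths and supports of superpositions -/

section Reach

variable {ι : Type} [Fintype ι] [DecidableEq ι] {A : ι → Alphabet}

/-- `c` is reached on input `x` after `t` steps of nonzero amplitude. -/
inductive Reach (M : QTM ι A) (x : Input A) : ℕ → Config M.Q A → Prop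
  | zero : Reach M x 0 (M.init x)
  | succ {t c c'} : Reach M x t c → M.stepConfig c c' ≠ 0 → Reach M x (t + 1) c'

theorem IsPath.reach {M : QTM ι A} {x : Input A} {γ : ℕ → Config M.Q A} (h : M.IsPath x γ)
    (t : ℕ) : M.Reach x t (γ t) := by
  induction t with
  | zero => exact h.1 ▸ .zero
  | succ t ih => exact ih.succ (h.2 t)

theorem evolution_single (M : QTM ι A) (c : Config M.Q A) :
    M.evolution (Finsupp.single c 1) = M.stepConfig c := by
  simp [evolution]

open Classical in
/-- The push-forward of a function on a finite type. -/
noncomputable def pushAmp {X R : Type} [Fintype X] (f : X → R) (a : X → ℂ) (r : R) : ℂ :=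
  ∑ u, if r = f u then a u else 0

/-- Amplitudes given as a push-forward allow the step to be summed over the parameters `X`; `f` need
not be injective, since coinciding terms simply add. -/
theorem stepConfig_of_pushAmp (M : QTM ι A) {X : Type} [Fintype X]
    (f : X → M.Q × (∀ i, (A i).Sym) × (ι → Dir)) (a : X → ℂ) (c : Config M.Q A)
    (h : M.δ c.state c.scanned = pushAmp f a) :
    M.stepConfig c = ∑ u, Finsupp.single (c.update (f u).1 (f u).2.1 (f u).2.2) (a u) := by
  classical
  have hs : ∀ r, Finsupp.single (c.update r.1 r.2.1 r.2.2) (M.δ c.state c.scanned r) =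
      ∑ u, if r = f u then Finsupp.single (c.update r.1 r.2.1 r.2.2) (a u) else 0 := by
    intro r
    rw [h, pushAmp, ← Finsupp.singleAddHom_apply, map_sum]
    refine Finset.sum_congr rfl fun u _ => ?_
    split_ifs <;> simp
  unfold stepConfig
  simp only [hs]
  rw [Finset.sum_comm]
  refine Finset.sum_congr rfl fun u _ => ?_
  rw [Finset.sum_ite_eq' Finset.univ, if_pos (Finset.mem_univ _)]

/-- By linearity it suffices to check basis vectors. The maps `f` and `g` may differ because the
clock changes during the step while `U` acts on the rest. -/
theorem evolution_mapDomain (M : QTM ι A) {X : Type} {f g : X → Config M.Q A}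
    (U : (X →₀ ℂ) →ₗ[ℂ] (X →₀ ℂ))
    (h : ∀ c, M.stepConfig (f c) = (U (Finsupp.single c 1)).mapDomain g) (φ : X →₀ ℂ) :
    M.evolution (φ.mapDomain f) = (U φ).mapDomain g := by
  induction φ using Finsupp.induction_linear with
  | zero => simp
  | add φ ψ hφ hψ => simp only [Finsupp.mapDomain_add, map_add, hφ, hψ]
  | single c a =>
    rw [Finsupp.mapDomain_single, ← mul_one a, ← smul_eq_mul, ← Finsupp.smul_single,
      ← Finsupp.smul_single, map_smul, map_smul, evolution_single, Finsupp.mapDomain_smul, h]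

theorem WellFormed.exists_step {M : QTM ι A} (hM : M.WellFormed) (c : Config M.Q A) :
    ∃ c', M.stepConfig c c' ≠ 0 := by
  by_contra! h
  have h0 : M.stepConfig c = 0 := Finsupp.ext h
  have := hM (Finsupp.single c 1)
  rw [evolution_single, h0] at this
  simp [l2norm] at this

/-- Norm preservation forbids dead ends, so a finite history always extends to an infinite path.
This turns statements about paths into statements about reachable configurations. -/
theorem Reach.exists_path {M : QTM ι A} (hM : M.WellFormed) {x : Input A} {t : ℕ}
    {c : Config M.Q A} (h : M.Reach x t c) : ∃ γ, M.IsPath x γ ∧ γ t = c := by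
  induction h with
  | zero =>
    choose f hf using hM.exists_step
    refine ⟨fun t => f^[t] (M.init x), ⟨rfl, fun t => ?_⟩, rfl⟩
    simp only [Function.iterate_succ_apply']
    exact hf _
  | @succ t c c' _ hs ih =>
    obtain ⟨γ, hγ, hc⟩ := ih
    choose f hf using hM.exists_step
    -- Follow the given path up to time `t`, then iterate an arbitrary choice of successor from
    -- `c'`.
    refine ⟨fun s => if s ≤ t then γ s else f^[s - (t + 1)] c', ⟨?_, fun s => ?_⟩, ?_⟩
    · simp [hγ.1]
    · rcases lt_trichotomy s t with h | rfl | h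
      · simp only [if_pos h.le, if_pos (Nat.succ_le_of_lt h)]
        exact hγ.2 s
      · simpa [hc] using hs
      · have : s + 1 - (t + 1) = (s - (t + 1)) + 1 := by omega
        simp only [if_neg (show ¬ s ≤ t by omega), if_neg (show ¬ s + 1 ≤ t by omega), this,
          Function.iterate_succ_apply']
        exact hf _
    · simp

/-- Only this direction holds in general: amplitudes of different paths to the same configuration
may cancel. -/
theorem reach_of_evolution_ne_zero {M : QTM ι A} {x : Input A} {t : ℕ} {c : Config M.Q A}
    (h : (M.evolution ^ t) (Finsupp.single (M.init x) 1) c ≠ 0) : M.Reach x t c := by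
  classical
  induction t generalizing c with
  | zero =>
    rw [pow_zero, Module.End.one_apply, Finsupp.single_apply] at h
    split_ifs at h with hc
    · exact hc ▸ .zero
    · exact absurd rfl h
  | succ t ih =>
    rw [pow_succ', Module.End.mul_apply, evolution, Finsupp.linearCombination_apply,
      Finsupp.sum_apply] at h
    obtain ⟨d, hd, hd'⟩ := Finset.exists_ne_zero_of_sum_ne_zero h
    simp only [Finsupp.smul_apply, smul_eq_mul] at hd'
    exact (ih (left_ne_zero_of_mul hd')).succ (right_ne_zero_of_mul hd')

theorem HaltsIn.time_eq {M : QTM ι A} {x : Input A} {t : ℕ} (h : M.HaltsIn x t) :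
    M.time x = t :=
  h.csInf_eq

theorem HaltsIn.isFinal_of_reach {M : QTM ι A} (hM : M.WellFormed) {x : Input A} {t : ℕ}
    (h : M.HaltsIn x t) {c : Config M.Q A} (hc : M.Reach x t c) : M.IsFinal c := by
  obtain ⟨γ, hγ, rfl⟩ := hc.exists_path hM
  exact h.1 γ hγ

end Reach

/-! ### The reversible local rule of the clock -/

/-- The phases of the clock. -/
inductive Phase where
  | fwd | back | fin
  deriving DecidableEq

instance : Fintype Phase where
  elems := {.fwd, .back, .fin}
  complete p := by cases p <;> simp

/-- The phase entered when the clock scans a symbol other than `1`. -/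
def Phase.next : Phase → Phase
  | fwd => back
  | back => fin
  -- This value is never used before halting; it makes `next` a permutation.
  | fin => fwd

/-- The direction in which a phase is entered. -/
def Phase.dir : Phase → Dir
  | fwd => .R
  | back => .L
  | fin => .R

theorem Phase.next_injective : Function.Injective Phase.next := by
  intro p p' h
  cases p <;> cases p' <;> first | rfl | cases h

/-- The alphabet of the clock tape and of the register tape: the symbol `none` is the `1` of the
clock, the symbols `some q` can store a state, and `some b` is the blank. -/
abbrev clockAlphabet (Q : Type) [Fintype Q] [DecidableEq Q] (b : Q) : Alphabet where
  Sym := Option Q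
  blank := some b

section Clock

variable {Q κ : Type} [DecidableEq κ]

/-- Exchange a state with the state stored in component `j`. -/
def swapReg (j : κ) (q : Q) (b : κ → Option Q) : Q × (κ → Option Q) :=
  match b j with
  | some g => (g, Function.update b j (some q))
  | none => (q, b)

theorem swapReg_swapReg (j : κ) (q : Q) (b : κ → Option Q) :
    swapReg j (swapReg j q b).1 (swapReg j q b).2 = (q, b) := by
  cases h : b j with
  | none => simp [swapReg, h]
  | some g =>
    simp only [swapReg, h, Function.update_self, Function.update_idem]
    rw [← h, Function.update_eq_self]

/-- An exchange stores `some q`, never the clock symbol `none`. Hence even for `i = j` the test for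
a one gives the same answer before and after, which makes the rule invertible. -/
theorem swapReg_eq_none_iff (i j : κ) (q : Q) (b : κ → Option Q) :
    (swapReg j q b).2 i = none ↔ b i = none := by
  cases h : b j with
  | none => simp [swapReg, h]
  | some g =>
    rcases eq_or_ne i j with rfl | hij
    · simp [swapReg, h]
    · simp [swapReg, h, Function.update_of_ne hij]

open Classical in
/-- The phase after a step of the clock. -/
noncomputable def phaseStep (i : κ) (p : Phase) (b : κ → Option Q) : Phase :=
  if b i = none then p else p.next

open Classical in
/-- The action of a step of the clock on the state and on the scanned symbols. -/
noncomputable def regStep (i j : κ) (p : Phase) (q : Q) (b : κ → Option Q) :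
    Q × (κ → Option Q) :=
  if p = .back ∧ b i ≠ none then swapReg j q b else (q, b)

theorem regStep_eq_none_iff (i j : κ) (p : Phase) (q : Q) (b : κ → Option Q) :
    (regStep i j p q b).2 i = none ↔ b i = none := by
  unfold regStep
  split_ifs
  · exact swapReg_eq_none_iff i j q b
  · rfl

/-- The local rule of the clock is reversible. -/
theorem clock_injective {i j : κ} {p p' : Phase} {q q' : Q} {b b' : κ → Option Q}
    (hp : phaseStep i p b = phaseStep i p' b') (hr : regStep i j p q b = regStep i j p' q' b') :
    p = p' ∧ q = q' ∧ b = b' := by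
  have hn : b i = none ↔ b' i = none := by
    rw [← regStep_eq_none_iff i j p q b, hr, regStep_eq_none_iff]
  -- Both sides agree on whether a one was scanned, so either the phase was kept or `next` was
  -- applied in both.
  have hpp : p = p' := by
    unfold phaseStep at hp
    by_cases h : b i = none
    · rwa [if_pos h, if_pos (hn.mp h)] at hp
    · rw [if_neg h, if_neg (mt hn.mpr h)] at hp
      exact Phase.next_injective hp
  subst hpp
  refine ⟨rfl, Prod.mk.inj ?_⟩
  unfold regStep at hr
  by_cases h : p = .back ∧ b i ≠ none
  · rw [if_pos h, if_pos ⟨h.1, mt hn.mpr h.2⟩] at hr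
    rw [← swapReg_swapReg j q b, hr, swapReg_swapReg]
  · rw [if_neg h, if_neg fun h' => h ⟨h'.1, mt hn.mp h'.2⟩] at hr
    exact hr

end Clock

/-! ### The clocked machine and its well-formedness -/

section Machine

variable {ι κ : Type} [Fintype ι] [DecidableEq ι] [Fintype κ] [DecidableEq κ]
  {A : ι → Alphabet}

/-- The clock alphabets for the machine `M`. -/
abbrev clockAlphabets (M : QTM ι A) (κ : Type) (z : M.Q) : κ → Alphabet :=
  fun _ => clockAlphabet M.Q z

/-- Configurations of the clock. -/
abbrev ClockConfig (M : QTM ι A) (κ : Type) (z : M.Q) : Type :=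
  Config Phase (clockAlphabets M κ z)

open Classical in
/-- The amplitude with which the machine controlled by a clock acts on the tapes of `M`. -/
noncomputable def clockAmp (M : QTM ι A) (i : κ) (q : M.Q) (p : Phase) (σ : ∀ i, (A i).Sym)
    (b : κ → Option M.Q) (u : M.Q × (∀ i, (A i).Sym) × (ι → Dir)) : ℂ :=
  if p = .fwd ∧ b i = none then M.δ q σ u else if u = (q, σ, fun _ => .N) then 1 else 0

/-- The machine `M` controlled by a clock on tape `i`. In phase `fwd` it runs `M` as long as the
clock scans `1`; the clock moves to the first cell without `1`, then back to the last cell before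
the ones, where the state of `M` is exchanged with the symbol scanned on tape `j`. -/
noncomputable def clocked (M : QTM ι A) (z : M.Q) (i j : κ) :
    QTM (ι ⊕ κ) (Sum.elim A (clockAlphabets M κ z)) where
  Q := M.Q × Phase
  q₀ := (M.q₀, .fwd)
  final := {(z, .fin)}
  δ s σ :=
    let b : κ → Option M.Q := fun l => σ (.inr l)
    let p := phaseStep i s.2 b
    -- The register acts on the state `u.1` reached after the move of `M`, and the clock heads move
    -- in a direction determined by the new phase alone.
    pushAmp (fun u => (((regStep i j s.2 u.1 b).1, p),
        pairSym u.2.1 (regStep i j s.2 u.1 b).2, Sum.elim u.2.2 fun _ => p.dir))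
      (clockAmp M i s.1 s.2 (fun l => σ (.inl l)) b)

variable {M : QTM ι A} {z : M.Q}

/-- The configuration made of a configuration of `M` and a configuration of the clock. -/
def clockJoin (i j : κ) (w : ClockConfig M κ z) (c : Config M.Q A) :
    Config (M.clocked z i j).Q (Sum.elim A (clockAlphabets M κ z)) :=
  join c w

/-- The configuration after a step of the clock. -/
noncomputable def clockStep (i j : κ) (w : ClockConfig M κ z) (c : Config M.Q A) :
    Config (M.clocked z i j).Q (Sum.elim A (clockAlphabets M κ z)) :=
  let r := regStep i j w.state c.state w.scanned
  let p := phaseStep i w.state w.scanned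
  joinWith (r.1, p) c (w.update p r.2 fun _ => p.dir)

/-- The new phase determines the last clock move, so the old head positions can be recovered. Then
the written symbols can be read off and the local rule undone by `clock_injective`. -/
theorem clockStep_injective (i j : κ) {w w' : ClockConfig M κ z} {c c' : Config M.Q A}
    (h : clockStep i j w c = clockStep i j w' c') : w = w' ∧ c = c' := by
  obtain ⟨hs, h1, h2, h3, h4⟩ := joinWith_inj h
  obtain ⟨hr, hp⟩ := Prod.mk.inj hs
  have hh : w.head = w'.head := by
    funext l
    have := congrFun h4 l
    simp only [Config.update, hp] at this
    exact add_right_cancel this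
  have hb : (regStep i j w.state c.state w.scanned).2 =
      (regStep i j w'.state c'.state w'.scanned).2 := by
    funext l
    have := congrFun (congrFun h3 l) (w.head l)
    simpa [Config.update, hh] using this
  obtain ⟨h5, h6, h7⟩ := clock_injective hp (Prod.ext hr hb)
  refine ⟨Config.ext h5 (funext fun l => funext fun y => ?_) hh, Config.ext h6 h1 h2⟩
  by_cases hy : y = w.head l
  · have := congrFun h7 l
    simp only [Config.scanned] at this
    rw [hy, this, hh]
  · have := congrFun (congrFun h3 l) y
    simp only [Config.update] at this
    rwa [Function.update_of_ne hy, Function.update_of_ne (hh ▸ hy)] at this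

/-- The clock lets `M` run. -/
def Runs (i : κ) (w : ClockConfig M κ z) : Prop := w.state = .fwd ∧ w.scanned i = none

theorem clockStep_update (i j : κ) (w : ClockConfig M κ z) (c : Config M.Q A)
    (u : M.Q × (∀ i, (A i).Sym) × (ι → Dir)) :
    (clockJoin i j w c).update
        ((regStep i j w.state u.1 w.scanned).1, phaseStep i w.state w.scanned)
        (pairSym u.2.1 (regStep i j w.state u.1 w.scanned).2)
        (Sum.elim u.2.2 fun _ => (phaseStep i w.state w.scanned).dir) =
      clockStep i j w (c.update u.1 u.2.1 u.2.2) :=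
  joinWith_update _ _ c w u.1 (phaseStep i w.state w.scanned) _ _ _ _

/-- A step factors into a quantum move on the tapes of `M` with the clock fixed, followed by the
deterministic map `clockStep`. -/
theorem stepConfig_clocked (i j : κ) (w : ClockConfig M κ z) (c : Config M.Q A) :
    (M.clocked z i j).stepConfig (clockJoin i j w c) =
      (∑ u : M.Q × (∀ i, (A i).Sym) × (ι → Dir),
        Finsupp.single (c.update u.1 u.2.1 u.2.2)
          (clockAmp M i c.state w.state c.scanned w.scanned u)).mapDomain (clockStep i j w) := by
  refine (stepConfig_of_pushAmp _ _ _ _ rfl).trans ?_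
  rw [Finsupp.mapDomain_finsetSum]
  refine Finset.sum_congr rfl fun u _ => ?_
  rw [Finsupp.mapDomain_single]
  exact congrArg (Finsupp.single · _) (clockStep_update i j w c u)

theorem stepConfig_clocked_of_runs {i : κ} (j : κ) {w : ClockConfig M κ z} (hw : Runs i w)
    (c : Config M.Q A) :
    (M.clocked z i j).stepConfig (clockJoin i j w c) =
      (M.stepConfig c).mapDomain (clockStep i j w) := by
  rw [stepConfig_clocked]
  have hw' : w.state = .fwd ∧ w.scanned i = none := hw
  simp only [clockAmp, if_pos hw']
  rfl

theorem stepConfig_clocked_of_not_runs {i : κ} (j : κ) {w : ClockConfig M κ z}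
    (hw : ¬ Runs i w) (c : Config M.Q A) :
    (M.clocked z i j).stepConfig (clockJoin i j w c) =
      Finsupp.single (clockStep i j w c) 1 := by
  have hw' : ¬ (w.state = .fwd ∧ w.scanned i = none) := hw
  rw [stepConfig_clocked, Finset.sum_eq_single (c.state, c.scanned, fun _ => Dir.N)]
  · rw [clockAmp, if_neg hw', if_pos rfl, Config.update_self, Finsupp.mapDomain_single]
  · intro u _ hu
    rw [clockAmp, if_neg hw', if_neg hu, Finsupp.single_zero]
  · exact fun h => absurd (Finset.mem_univ _) h

theorem evolution_clocked_of_runs {i : κ} (j : κ) {w : ClockConfig M κ z} (hw : Runs i w)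
    (φ : Superposition M.Q A) :
    (M.clocked z i j).evolution (φ.mapDomain (clockJoin i j w)) =
      (M.evolution φ).mapDomain (clockStep i j w) := by
  refine evolution_mapDomain _ M.evolution (fun c => ?_) φ
  rw [stepConfig_clocked_of_runs j hw, evolution_single]

theorem evolution_clocked_of_not_runs {i : κ} (j : κ) {w : ClockConfig M κ z} (hw : ¬ Runs i w)
    (φ : Superposition M.Q A) :
    (M.clocked z i j).evolution (φ.mapDomain (clockJoin i j w)) =
      φ.mapDomain (clockStep i j w) := by
  refine evolution_mapDomain _ LinearMap.id (fun c => ?_) φ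
  rw [stepConfig_clocked_of_not_runs j hw, LinearMap.id_apply, Finsupp.mapDomain_single]

open Classical in
theorem WellFormed.clocked (hM : M.WellFormed) (z : M.Q) (i j : κ) :
    (M.clocked z i j).WellFormed := by
  intro φ
  rw [l2norm_eq_iff]
  let U (w : ClockConfig M κ z) : Superposition M.Q A →ₗ[ℂ] Superposition M.Q A :=
    if Runs i w then M.evolution else LinearMap.id
  let F (x : ClockConfig M κ z × Config M.Q A) := clockStep i j x.1 x.2
  let E : ClockConfig M κ z × Config M.Q A ≃ Config (M.clocked z i j).Q _ :=
    joinEquiv M.Q Phase A (clockAlphabets M κ z)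
  let V : (ClockConfig M κ z × Config M.Q A →₀ ℂ) →ₗ[ℂ]
      (ClockConfig M κ z × Config M.Q A →₀ ℂ) :=
    Finsupp.linearCombination ℂ fun x => (U x.1 (Finsupp.single x.2 1)).mapDomain (Prod.mk x.1)
  have hU : ∀ w ψ, normSq (U w ψ) = normSq ψ := by
    intro w ψ
    by_cases hw : Runs i w
    · simp only [U, if_pos hw]
      exact (l2norm_eq_iff _ _).mp (hM ψ)
    · simp only [U, if_neg hw, LinearMap.id_apply]
  have hV : ∀ w ψ, V (ψ.mapDomain (Prod.mk w)) = (U w ψ).mapDomain (Prod.mk w) := by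
    intro w ψ
    induction ψ using Finsupp.induction_linear with
    | zero => simp
    | add f g hf hg => simp only [Finsupp.mapDomain_add, map_add, hf, hg]
    | single c a =>
      rw [Finsupp.mapDomain_single, Finsupp.linearCombination_single, ← Finsupp.mapDomain_smul,
        ← map_smul, Finsupp.smul_single, smul_eq_mul, mul_one]
  have hF : Function.Injective F := fun x y h => Prod.ext_iff.mpr (clockStep_injective i j h)
  -- In the coordinates (clock, `M`), the evolution is the controlled isometry `V` followed by the
  -- injection `F`.
  have key : ∀ ψ, (M.clocked z i j).evolution (ψ.mapDomain E) = (V ψ).mapDomain F := by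
    refine evolution_mapDomain _ V fun ⟨w, c⟩ => ?_
    rw [← Finsupp.mapDomain_single, hV, ← Finsupp.mapDomain_comp]
    by_cases hw : Runs i w
    · simp only [U, if_pos hw]
      rw [evolution_single]
      exact stepConfig_clocked_of_runs j hw c
    · simp only [U, if_neg hw, LinearMap.id_apply, Finsupp.mapDomain_single]
      exact stepConfig_clocked_of_not_runs j hw c
  have hφ : φ = (φ.mapDomain E.symm).mapDomain E := by
    rw [← Finsupp.mapDomain_comp, E.self_comp_symm, Finsupp.mapDomain_id]
  rw [hφ, key, normSq_mapDomain hF, normSq_mapDomain E.injective, normSq_controlled U hU V hV]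

end Machine

/-- The part of an input for the tapes `ι`. -/
def leftInput {ι κ : Type} {A : ι → Alphabet} {B : κ → Alphabet} (y : Input (Sum.elim A B)) :
    Input A :=
  fun l => y (.inl l)

/-! ### Leading ones of a clock input -/

section LeadingOnes

variable {Q : Type} [Fintype Q] [DecidableEq Q] {z : Q}

theorem inputTape_neg {Γ : Alphabet} (l : List Γ.NonBlank) {h : ℤ} (hh : h < 0) :
    inputTape l h = Γ.blank :=
  if_neg (not_le.mpr hh)

theorem inputTape_length {Γ : Alphabet} (l : List Γ.NonBlank) :
    inputTape l (l.length : ℤ) = Γ.blank := by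
  simp [inputTape]

/-- The cell just after the input is blank, and the blank is not the symbol `none`. -/
theorem exists_inputTape_ne_none (l : List (clockAlphabet Q z).NonBlank) :
    ∃ n : ℕ, inputTape l n ≠ none :=
  ⟨l.length, by rw [inputTape_length]; exact Option.some_ne_none z⟩

open Classical in
/-- The number of leading ones of an input on the clock tape. -/
noncomputable def leadingOnes (l : List (clockAlphabet Q z).NonBlank) : ℕ :=
  Nat.find (exists_inputTape_ne_none l)

theorem inputTape_leadingOnes (l : List (clockAlphabet Q z).NonBlank) :
    inputTape l (leadingOnes l) ≠ none := by
  classical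
  exact Nat.find_spec (exists_inputTape_ne_none l)

theorem inputTape_of_lt_leadingOnes (l : List (clockAlphabet Q z).NonBlank) {h : ℤ}
    (h0 : 0 ≤ h) (hn : h < leadingOnes l) : inputTape l h = none := by
  classical
  obtain ⟨m, rfl⟩ := Int.eq_ofNat_of_zero_le h0
  exact not_not.mp (Nat.find_min (exists_inputTape_ne_none l) (Int.ofNat_lt.mp hn))

theorem leadingOnes_replicate (one : (clockAlphabet Q z).NonBlank) (h : one.1 = none) (n : ℕ) :
    leadingOnes (List.replicate n one) = n := by
  classical
  refine (Nat.find_eq_iff _).mpr ⟨?_, fun m hm => ?_⟩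
  · have := inputTape_length (List.replicate n one)
    rw [List.length_replicate] at this
    rw [this]
    exact Option.some_ne_none z
  · simp [inputTape, hm, h]

end LeadingOnes

/-! ### The run of the clocked machine -/

section Dynamics

variable {ι κ : Type} [Fintype ι] [DecidableEq ι] [Fintype κ] [DecidableEq κ]
  {A : ι → Alphabet} {M : QTM ι A} {z : M.Q}

/-- The configuration of the clock in phase `p` with all heads on cell `h` and the input `y`. -/
def inputClock (y : Input (Sum.elim A (clockAlphabets M κ z))) (p : Phase) (h : ℤ) :
    ClockConfig M κ z where
  state := p
  tape l := inputTape (y (.inr l))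
  head _ := h
  finite_nonblank l := inputTape_finite (y (.inr l))

/-- The number of steps of `M` that are performed on input `y`. -/
noncomputable def clockTime (i : κ) (y : Input (Sum.elim A (clockAlphabets M κ z))) : ℕ :=
  leadingOnes (Q := M.Q) (z := z) (y (.inr i))

/-- The configuration of the clock after `t ≤ 2 * clockTime i y + 1` steps. -/
noncomputable def clockAt (i : κ) (y : Input (Sum.elim A (clockAlphabets M κ z))) (t : ℕ) :
    ClockConfig M κ z :=
  if t ≤ clockTime i y then inputClock y .fwd t
  else inputClock y .back (2 * clockTime i y - t)

variable (i j : κ) (y : Input (Sum.elim A (clockAlphabets M κ z)))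

/-- The first final configuration, given the configuration of `M`. -/
noncomputable def clockEnd (c : Config M.Q A) :
    Config (M.clocked z i j).Q (Sum.elim A (clockAlphabets M κ z)) :=
  clockStep i j (clockAt i y (2 * clockTime i y + 1)) c

theorem init_clocked :
    (M.clocked z i j).init y = clockJoin i j (clockAt i y 0) (M.init (leftInput y)) := by
  rw [clockAt, if_pos (Nat.zero_le _)]
  refine Config.ext rfl (funext fun l => ?_) (funext fun l => ?_) <;> cases l <;> rfl

theorem runs_clockAt {t : ℕ} (ht : t < clockTime i y) : Runs i (clockAt i y t) := by
  rw [clockAt, if_pos ht.le]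
  exact ⟨rfl, inputTape_of_lt_leadingOnes (Q := M.Q) (z := z) _ (Int.natCast_nonneg t)
    (Int.ofNat_lt.mpr ht)⟩

theorem not_runs_clockAt {t : ℕ} (ht : clockTime i y ≤ t) : ¬ Runs i (clockAt i y t) := by
  unfold clockAt
  split_ifs with h
  · obtain rfl := le_antisymm h ht
    exact fun hr => inputTape_leadingOnes (Q := M.Q) (z := z) _ hr.2
  · exact fun hr => Phase.noConfusion hr.1

theorem clockStep_of_scanned_eq_none {w : ClockConfig M κ z} (hw : w.scanned i = none)
    (c : Config M.Q A) : clockStep i j w c =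
      clockJoin i j (w.update w.state w.scanned fun _ => w.state.dir) c := by
  simp only [clockStep, regStep, phaseStep, hw]
  simp
  rfl

theorem clockStep_of_fwd {w : ClockConfig M κ z} (hw : w.scanned i ≠ none)
    (hs : w.state = .fwd) (c : Config M.Q A) : clockStep i j w c =
      clockJoin i j (w.update .back w.scanned fun _ => .L) c := by
  simp only [clockStep, regStep, phaseStep, hw, hs]
  simp
  rfl

theorem inputClock_update (p q : Phase) (h : ℤ) (d : Dir) :
    (inputClock y p h).update q (inputClock y p h).scanned (fun _ => d) =
      inputClock y q (h + d.shift) :=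
  Config.ext rfl (funext fun _ => Function.update_eq_self _ _) rfl

/-- The cases are the forward sweep, the turn on cell `clockTime i y`, and the backward sweep, in
which cells `clockTime i y - 1` down to `0` are scanned. -/
theorem clockStep_clockAt {t : ℕ} (ht : t < 2 * clockTime i y + 1) (c : Config M.Q A) :
    clockStep i j (clockAt i y t) c = clockJoin i j (clockAt i y (t + 1)) c := by
  rcases lt_trichotomy t (clockTime i y) with h | h | h
  · rw [clockStep_of_scanned_eq_none _ _ (runs_clockAt i y h).2, clockAt, if_pos h.le,
      inputClock_update, clockAt, if_pos (Nat.succ_le_of_lt h)]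
    rfl
  · have hs : (clockAt i y t).state = .fwd := by rw [clockAt, if_pos h.le]; rfl
    rw [clockStep_of_fwd _ _ (fun hn => not_runs_clockAt i y h.ge ⟨hs, hn⟩) hs, clockAt,
      if_pos h.le, inputClock_update, clockAt, if_neg (by omega)]
    congr 2
    simp only [Dir.shift]
    omega
  · have hn : (clockAt i y t).scanned i = none := by
      rw [clockAt, if_neg (not_le.mpr h)]
      refine inputTape_of_lt_leadingOnes (Q := M.Q) (z := z) _ ?_ ?_
      · simp only [inputClock]; omega
      · change 2 * (clockTime i y : ℤ) - t < clockTime i y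
        omega
    rw [clockStep_of_scanned_eq_none _ _ hn, clockAt, if_neg (not_le.mpr h), inputClock_update,
      clockAt, if_neg (by omega)]
    congr 2
    simp only [Dir.shift, inputClock, Phase.dir]
    push_cast
    ring

theorem clockAt_last : clockAt i y (2 * clockTime i y + 1) = inputClock y .back (-1) := by
  rw [clockAt, if_neg (by omega)]
  congr 1
  push_cast
  ring

theorem clockEnd_eq (c : Config M.Q A) : clockEnd i j y c =
    joinWith (z, .fin) c ((inputClock y .back (-1)).update .fin
      (Function.update (fun _ => some z) j (some c.state)) fun _ => .R) := by
  -- Inputs start at cell `0`, so every extra tape carries the blank `some z` at cell `-1`; the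
  -- exchange therefore always produces the state `z`.
  have hs : (inputClock y .back (-1)).scanned = fun _ => some z := by
    funext l
    change inputTape (Γ := clockAlphabet M.Q z) (y (.inr l)) (-1) = (clockAlphabet M.Q z).blank
    exact inputTape_neg _ (by decide)
  rw [clockEnd, clockAt_last]
  simp only [clockStep, hs]
  simp [regStep, phaseStep, swapReg, inputClock, Phase.next, Phase.dir]
  rfl

theorem clockEnd_state (c : Config M.Q A) : (clockEnd i j y c).state = (z, .fin) := by
  rw [clockEnd_eq]
  rfl

theorem clockEnd_head (c : Config M.Q A) (l : κ) : (clockEnd i j y c).head (.inr l) = 0 := by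
  rw [clockEnd_eq]
  rfl

theorem clockEnd_tape_inl (c : Config M.Q A) (l : ι) :
    (clockEnd i j y c).tape (.inl l) = c.tape l := by
  rw [clockEnd_eq]
  rfl

/-- Only cell `-1` of the register tape is rewritten, and storing `z` there rewrites the blank by
itself. -/
theorem clockEnd_tape_inr (c : Config M.Q A) {l : κ} (h : l ≠ j ∨ c.state = z) :
    (clockEnd i j y c).tape (.inr l) = inputTape (y (.inr l)) := by
  have hb : Function.update (fun _ => some z) j (some c.state) l = some z := by
    rcases h with h | h
    · rw [Function.update_of_ne h]
    · rw [h, Function.update_eq_self_iff.mpr rfl]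
  rw [clockEnd_eq]
  change Function.update (inputTape (y (.inr l))) (-1)
    (Function.update (fun _ => some z) j (some c.state) l) = _
  rw [hb]
  exact Function.update_eq_self_iff.mpr (inputTape_neg (y (.inr l)) (h := -1) (by decide)).symm

theorem clockEnd_injective : Function.Injective (clockEnd i j y) :=
  fun _ _ h => (clockStep_injective i j h).2

/-- The clock is deterministic and `M` is frozen once the ones are used up, whence the minimum in
the time of `M`. -/
theorem reach_clocked {t : ℕ} (ht : t ≤ 2 * clockTime i y + 1)
    {d : Config (M.clocked z i j).Q (Sum.elim A (clockAlphabets M κ z))}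
    (hd : (M.clocked z i j).Reach y t d) :
    ∃ c, M.Reach (leftInput y) (min t (clockTime i y)) c ∧
      d = clockJoin i j (clockAt i y t) c := by
  induction hd with
  | zero => exact ⟨_, by rw [Nat.zero_min]; exact .zero, init_clocked i j y⟩
  | @succ t d d' _ hs ih =>
    obtain ⟨c, hc, rfl⟩ := ih (by omega)
    by_cases h : t < clockTime i y
    · rw [stepConfig_clocked_of_runs j (runs_clockAt i y h)] at hs
      classical
      obtain ⟨c', hc', rfl⟩ := Finset.mem_image.mp
        (Finsupp.mapDomain_support (Finsupp.mem_support_iff.mpr hs))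
      refine ⟨c', ?_, clockStep_clockAt i j y (by omega) c'⟩
      rw [min_eq_left h.le] at hc
      rw [min_eq_left (Nat.succ_le_of_lt h)]
      exact hc.succ (Finsupp.mem_support_iff.mp hc')
    · rw [not_lt] at h
      rw [stepConfig_clocked_of_not_runs j (not_runs_clockAt i y h)] at hs
      refine ⟨c, ?_, ?_⟩
      · rwa [min_eq_right (by omega), ← min_eq_right h]
      · rw [← clockStep_clockAt i j y (by omega)]
        by_contra hne
        exact hs (Finsupp.single_eq_of_ne hne)

theorem reach_clocked_end {d : Config (M.clocked z i j).Q (Sum.elim A (clockAlphabets M κ z))}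
    (hd : (M.clocked z i j).Reach y (2 * clockTime i y + 2) d) :
    ∃ c, M.Reach (leftInput y) (clockTime i y) c ∧ d = clockEnd i j y c := by
  cases hd with
  | succ hd hs =>
    obtain ⟨c, hc, rfl⟩ := reach_clocked i j y le_rfl hd
    rw [stepConfig_clocked_of_not_runs j (not_runs_clockAt i y (by omega))] at hs
    refine ⟨c, ?_, ?_⟩
    · rwa [min_eq_right (by omega)] at hc
    · by_contra hne
      exact hs (Finsupp.single_eq_of_ne hne)

theorem evolution_pow_clocked {t : ℕ} (ht : t ≤ 2 * clockTime i y + 1) :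
    ((M.clocked z i j).evolution ^ t) (Finsupp.single ((M.clocked z i j).init y) 1) =
      ((M.evolution ^ min t (clockTime i y))
        (Finsupp.single (M.init (leftInput y)) 1)).mapDomain
          (clockJoin i j (clockAt i y t)) := by
  induction t with
  | zero =>
    rw [Nat.zero_min, pow_zero, pow_zero, Module.End.one_apply, Module.End.one_apply,
      Finsupp.mapDomain_single, init_clocked]
  | succ t ih =>
    rw [pow_succ', Module.End.mul_apply, ih (by omega)]
    have hf : clockStep i j (clockAt i y t) = clockJoin i j (clockAt i y (t + 1)) :=
      funext fun c => clockStep_clockAt i j y (by omega) c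
    by_cases h : t < clockTime i y
    · rw [evolution_clocked_of_runs j (runs_clockAt i y h), min_eq_left h.le,
        min_eq_left (Nat.succ_le_of_lt h), pow_succ', Module.End.mul_apply, hf]
    · rw [evolution_clocked_of_not_runs j (not_runs_clockAt i y (not_lt.mp h)), hf,
        min_eq_right (not_lt.mp h), min_eq_right (by omega)]

theorem evolution_pow_clocked_end :
    ((M.clocked z i j).evolution ^ (2 * clockTime i y + 2))
        (Finsupp.single ((M.clocked z i j).init y) 1) =
      ((M.evolution ^ clockTime i y) (Finsupp.single (M.init (leftInput y)) 1)).mapDomain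
        (clockEnd i j y) := by
  rw [pow_succ', Module.End.mul_apply, evolution_pow_clocked i j y le_rfl,
    evolution_clocked_of_not_runs j (not_runs_clockAt i y (by omega)), min_eq_right (by omega)]
  rfl

theorem isFinal_of_isPath_clocked {γ} (hγ : (M.clocked z i j).IsPath y γ) :
    (M.clocked z i j).IsFinal (γ (2 * clockTime i y + 2)) := by
  obtain ⟨c, -, hc⟩ := reach_clocked_end i j y (hγ.reach _)
  rw [hc]
  exact clockEnd_state i j y c

theorem not_isFinal_of_isPath_clocked {γ} (hγ : (M.clocked z i j).IsPath y γ) {t : ℕ}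
    (ht : t < 2 * clockTime i y + 2) : ¬ (M.clocked z i j).IsFinal (γ t) := by
  obtain ⟨c, -, hc⟩ := reach_clocked i j y (Nat.le_of_lt_succ ht) (hγ.reach t)
  rw [hc]
  intro h
  have hp : (clockAt i y t).state = .fin := (Prod.mk.inj h).2
  unfold clockAt at hp
  split_ifs at hp <;> exact Phase.noConfusion hp

theorem reachesFinalAt_clocked {γ} (hγ : (M.clocked z i j).IsPath y γ) (t : ℕ) :
    (M.clocked z i j).ReachesFinalAt γ t ↔ t = 2 * clockTime i y + 2 := by
  have h : IsLeast {s | (M.clocked z i j).IsFinal (γ s)} (2 * clockTime i y + 2) :=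
    ⟨isFinal_of_isPath_clocked i j y hγ, fun s hs => not_lt.mp fun hlt =>
      not_isFinal_of_isPath_clocked i j y hγ hlt hs⟩
  exact ⟨fun ht => ht.unique h, fun ht => ht ▸ h⟩

theorem synchronous_clocked : (M.clocked z i j).Synchronous := fun y _ _ hγ hγ' t => by
  rw [reachesFinalAt_clocked i j y hγ, reachesFinalAt_clocked i j y hγ']

/-- Minimality needs at least one path, since otherwise every time would vacuously be a halting
time; well-formedness provides it. -/
theorem haltsIn_clocked (hM : M.WellFormed) :
    (M.clocked z i j).HaltsIn y (2 * clockTime i y + 2) := by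
  refine ⟨fun γ hγ => isFinal_of_isPath_clocked i j y hγ, fun s hs => not_lt.mp fun hlt => ?_⟩
  obtain ⟨γ, hγ, -⟩ := Reach.exists_path (hM.clocked z i j) (Reach.zero (x := y))
  exact not_isFinal_of_isPath_clocked i j y hγ hlt (hs γ hγ)

theorem finalSuperposition_clocked (hM : M.WellFormed)
    (hT : M.HaltsIn (leftInput y) (clockTime i y)) :
    (M.clocked z i j).finalSuperposition y =
      (M.finalSuperposition (leftInput y)).mapDomain (clockEnd i j y) := by
  rw [finalSuperposition, (haltsIn_clocked i j y hM).time_eq, evolution_pow_clocked_end,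
    finalSuperposition, hT.time_eq]

theorem acceptProb_clocked (hM : M.WellFormed) (hT : M.HaltsIn (leftInput y) (clockTime i y))
    (o : ι) (s : (A o).Sym) :
    (M.clocked z i j).acceptProb (.inl o) s y = M.acceptProb o s (leftInput y) := by
  unfold acceptProb
  rw [finalSuperposition_clocked i j y hM hT]
  refine (Finsupp.sum_mapDomain_index_inj (clockEnd_injective i j y)).trans ?_
  exact Finsupp.sum_congr fun c _ => by rw [clockEnd_tape_inl]; rfl

end Dynamics

/-! ### The machine with idle tapes -/

section Idle

variable {ι κ : Type} [Fintype ι] [DecidableEq ι] [Fintype κ] [DecidableEq κ]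
  {A : ι → Alphabet} {B : κ → Alphabet} (M : QTM ι A)

/-- The configuration of the machine with idle tapes `w`, given the configuration of `M`. -/
def idleJoin (w : Config Unit B) (c : Config M.Q A) : Config (M.idle B).Q (Sum.elim A B) :=
  joinWith c.state c w

theorem idleJoin_injective (w : Config Unit B) : Function.Injective (M.idleJoin w) := by
  intro c c' h
  obtain ⟨hs, ht, hh, -⟩ := joinWith_inj h
  exact Config.ext hs ht hh

theorem stepConfig_idle (w : Config Unit B) (c : Config M.Q A) :
    (M.idle B).stepConfig (M.idleJoin w c) = (M.stepConfig c).mapDomain (M.idleJoin w) := by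
  refine (stepConfig_of_pushAmp (M.idle B) (fun u : M.Q × (∀ i, (A i).Sym) × (ι → Dir) =>
    (u.1, pairSym u.2.1 w.scanned, Sum.elim u.2.2 fun _ => .N)) (M.δ c.state c.scanned) _ ?_).trans
    ?_
  · funext ⟨q, τ, d⟩
    unfold pushAmp idle
    dsimp only
    split_ifs with h
    -- If the extra tapes are left alone, the only parameter mapped to this transition is its
    -- restriction to the tapes of `M`.
    · refine Eq.trans ?_
        (Finset.sum_eq_single (q, (fun i => τ (.inl i)), fun i => d (.inl i)) ?_ ?_).symm
      · rw [if_pos]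
        · rfl
        · refine Prod.ext rfl (Prod.ext (funext fun i => ?_) (funext fun i => ?_)) <;>
            cases i
          · rfl
          · exact (h _).1
          · rfl
          · exact (h _).2
      · intro u _ hu
        refine if_neg fun h' => hu ?_
        obtain ⟨h1, h2⟩ := Prod.mk.inj h'
        obtain ⟨h2, h3⟩ := Prod.mk.inj h2
        subst h1 h2 h3
        rfl
      · exact fun h' => absurd (Finset.mem_univ _) h'
    · refine (Finset.sum_eq_zero fun u _ => if_neg fun h' => h fun l => ?_).symm
      obtain ⟨-, h2⟩ := Prod.mk.inj h'
      obtain ⟨h2, h3⟩ := Prod.mk.inj h2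
      subst h2 h3
      exact ⟨rfl, rfl⟩
  · rw [stepConfig, Finsupp.mapDomain_finsetSum]
    refine Finset.sum_congr rfl fun u _ => ?_
    rw [Finsupp.mapDomain_single]
    refine congrArg (Finsupp.single · _) ((joinWith_update _ _ c w u.1 () _ _ _ _).trans ?_)
    exact Config.ext rfl
      (congrArg (fun w' => (joinWith u.1 (c.update u.1 u.2.1 u.2.2) w').tape) w.update_self)
      (congrArg (fun w' => (joinWith u.1 (c.update u.1 u.2.1 u.2.2) w').head) w.update_self)

/-- The idle tapes with input `y` and the heads on the start cells. -/
def idleInput (y : Input (Sum.elim A B)) : Config Unit B where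
  state := ()
  tape j := inputTape (y (.inr j))
  head _ := 0
  finite_nonblank j := inputTape_finite (y (.inr j))

variable {M} (y : Input (Sum.elim A B))

theorem init_idle : (M.idle B).init y = M.idleJoin (idleInput y) (M.init (leftInput y)) := by
  refine Config.ext rfl (funext fun l => ?_) (funext fun l => ?_) <;> cases l <;> rfl

theorem reach_idle {t : ℕ} {d : Config (M.idle B).Q (Sum.elim A B)}
    (hd : (M.idle B).Reach y t d) :
    ∃ c, M.Reach (leftInput y) t c ∧ d = M.idleJoin (idleInput y) c := by
  classical
  induction hd with
  | zero => exact ⟨_, .zero, init_idle y⟩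
  | succ _ hs ih =>
    obtain ⟨c, hc, rfl⟩ := ih
    rw [stepConfig_idle] at hs
    obtain ⟨c', hc', rfl⟩ := Finset.mem_image.mp
      (Finsupp.mapDomain_support (Finsupp.mem_support_iff.mpr hs))
    exact ⟨c', hc.succ (Finsupp.mem_support_iff.mp hc'), rfl⟩

theorem IsPath.idle {γ : ℕ → Config M.Q A} (hγ : M.IsPath (leftInput y) γ) :
    (M.idle B).IsPath y fun t => M.idleJoin (idleInput y) (γ t) := by
  refine ⟨(congrArg _ hγ.1).trans (init_idle y).symm, fun t => ?_⟩
  rw [stepConfig_idle, Finsupp.mapDomain_apply (M.idleJoin_injective _)]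
  exact hγ.2 t

/-- Reachable configurations project to those of `M`, and paths of `M` lift, so the two halting
times bound each other. -/
theorem HaltsIn.idle (hM : M.WellFormed) {t : ℕ} (h : M.HaltsIn (leftInput y) t) :
    (M.idle B).HaltsIn y t := by
  refine ⟨fun γ hγ => ?_, fun s hs => h.2 fun γ hγ => hs _ (hγ.idle y)⟩
  obtain ⟨c, hc, hd⟩ := reach_idle y (hγ.reach t)
  rw [hd]
  exact h.isFinal_of_reach hM hc

theorem evolution_pow_idle (t : ℕ) :
    ((M.idle B).evolution ^ t) (Finsupp.single ((M.idle B).init y) 1) =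
      ((M.evolution ^ t) (Finsupp.single (M.init (leftInput y)) 1)).mapDomain
        (M.idleJoin (idleInput y)) := by
  induction t with
  | zero =>
    rw [pow_zero, pow_zero, Module.End.one_apply, Module.End.one_apply,
      Finsupp.mapDomain_single, init_idle]
  | succ t ih =>
    rw [pow_succ', pow_succ', Module.End.mul_apply, Module.End.mul_apply, ih]
    refine evolution_mapDomain _ M.evolution (fun c => ?_) _
    rw [stepConfig_idle, evolution_single]

theorem finalSuperposition_idle (hM : M.WellFormed) {t : ℕ}
    (h : M.HaltsIn (leftInput y) t) :
    (M.idle B).finalSuperposition y = (M.finalSuperposition (leftInput y)).mapDomain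
      (M.idleJoin (idleInput y)) := by
  unfold finalSuperposition
  rw [(h.idle y hM).time_eq, evolution_pow_idle, h.time_eq]

end Idle

/-! ### Comparison of the clocked and the idle machine -/

section Main

variable {ι : Type} [Fintype ι] [DecidableEq ι] {A : ι → Alphabet} {M : QTM ι A} {z : M.Q}

/-- The embedding of the states of `M` that sends `z` to the final state. -/
def stateEmbedding (M : QTM ι A) (z : M.Q) {κ : Type} [Fintype κ] [DecidableEq κ] (i j : κ) :
    M.Q ↪ (M.clocked z i j).Q where
  toFun q := (q, if q = z then .fin else .fwd)
  inj' _ _ h := (Prod.mk.inj h).1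

theorem clockEnd_eq_mapState {κ : Type} [Fintype κ] [DecidableEq κ] (i j : κ)
    (y : Input (Sum.elim A (clockAlphabets M κ z))) {c : Config M.Q A} (hc : c.state = z) :
    clockEnd i j y c =
      (M.idleJoin (idleInput y) c).mapState (stateEmbedding M z i j) := by
  refine Config.ext ?_ (funext fun l => ?_) (funext fun l => ?_)
  · rw [clockEnd_state]
    exact Prod.ext hc.symm (if_pos hc).symm
  · cases l with
    | inl l => exact clockEnd_tape_inl i j y c l
    | inr l => exact clockEnd_tape_inr i j y c (.inr hc)
  · rw [clockEnd_eq]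
    cases l <;> rfl

/-- At the halting time the superposition of `M` is supported on configurations in state `z`, and on
those `clockEnd` only relabels the state. The value of the embedding at other states plays no role.
-/
theorem finalSuperposition_clocked_eq_idle (hM : M.WellFormed) (hz : M.final = {z})
    {κ : Type} [Fintype κ] [DecidableEq κ] (i j : κ)
    (y : Input (Sum.elim A (clockAlphabets M κ z)))
    (hT : M.HaltsIn (leftInput y) (clockTime i y)) :
    (M.clocked z i j).finalSuperposition y =
      ((M.idle (clockAlphabets M κ z)).finalSuperposition y).mapDomain
        (Config.mapState (stateEmbedding M z i j)) := by
  rw [finalSuperposition_clocked i j y hM hT, finalSuperposition_idle y hM hT]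
  refine (Finsupp.mapDomain_congr fun c hc => clockEnd_eq_mapState i j y ?_).trans
    (Finsupp.mapDomain_comp (f := M.idleJoin (idleInput y)) (g := Config.mapState _))
  rw [finalSuperposition, hT.time_eq] at hc
  have := hT.isFinal_of_reach hM (reach_of_evolution_ne_zero (Finsupp.mem_support_iff.mp hc))
  rwa [IsFinal, hz] at this

theorem clockTime_clockInput {m : ℕ} (one : (clockAlphabet M.Q z).NonBlank) (h : one.1 = none)
    (x : Input A) (n : ℕ) :
    clockTime (M := M) (z := z) 0
      (clockInput (B := clockAlphabets M (Fin (m + 1)) z) one x n) = n :=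
  leadingOnes_replicate one h n

end Main

end QTM

theorem mainTheorem9 (k : ℕ) (A : Fin k → QTM.Alphabet) (M : QTM (Fin k) A)
    (hM : M.WellFormed) (T : QTM.Input A → ℕ) (hT : ∀ x, M.HaltsIn x (T x)) :
    (∃ (B : Fin 2 → QTM.Alphabet) (one : (B 0).NonBlank)
        (M' : QTM (Fin k ⊕ Fin 2) (Sum.elim A B)),
      M'.WellFormed ∧ M'.Synchronous ∧ M'.SingleFinal ∧
      ∀ x : QTM.Input A,
        M'.HaltsIn (QTM.clockInput one x (T x)) (2 * T x + 2) ∧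
        (∀ γ, M'.IsPath (QTM.clockInput one x (T x)) γ →
          (∀ j : Fin 2, (γ (2 * T x + 2)).head (Sum.inr j) = 0) ∧
          (γ (2 * T x + 2)).tape (Sum.inr 0) =
            QTM.inputTape (Γ := B 0) (List.replicate (T x) one)) ∧
        ∀ (o : Fin k) (s : (A o).Sym),
          M'.acceptProb (Sum.inl o) s (QTM.clockInput one x (T x)) = M.acceptProb o s x) ∧
    (M.SingleFinal →
      ∃ (B : Fin 1 → QTM.Alphabet) (one : (B 0).NonBlank)
        (M' : QTM (Fin k ⊕ Fin 1) (Sum.elim A B)) (e : M.Q ↪ M'.Q),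
      M'.WellFormed ∧ M'.Synchronous ∧ M'.SingleFinal ∧
      (∀ q ∈ M.final, e q ∈ M'.final) ∧
      ∀ x : QTM.Input A,
        M'.HaltsIn (QTM.clockInput one x (T x)) (2 * T x + 2) ∧
        (∀ γ, M'.IsPath (QTM.clockInput one x (T x)) γ →
          (γ (2 * T x + 2)).head (Sum.inr 0) = 0 ∧
          (γ (2 * T x + 2)).tape (Sum.inr 0) =
            QTM.inputTape (Γ := B 0) (List.replicate (T x) one)) ∧
        (∀ (o : Fin k) (s : (A o).Sym),
          M'.acceptProb (Sum.inl o) s (QTM.clockInput one x (T x)) = M.acceptProb o s x) ∧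
        M'.finalSuperposition (QTM.clockInput one x (T x)) =
          ((M.idle B).finalSuperposition (QTM.clockInput one x (T x))).mapDomain
            (QTM.Config.mapState e)) := by
  constructor
  · let one : (QTM.clockAlphabet M.Q M.q₀).NonBlank := ⟨none, (Option.some_ne_none _).symm⟩
    -- Any state can play the role of the blank here; `M.q₀` is one at hand. Tape `0` is the clock
    -- and tape `1` the register.
    refine ⟨QTM.clockAlphabets M (Fin 2) M.q₀, one, M.clocked M.q₀ 0 1, hM.clocked _ _ _,
      QTM.synchronous_clocked _ _, ⟨_, rfl⟩, fun x => ?_⟩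
    have hn := QTM.clockTime_clockInput (M := M) (m := 1) one rfl x (T x)
    set y := QTM.clockInput (B := QTM.clockAlphabets M (Fin 2) M.q₀) one x (T x)
    refine ⟨hn ▸ QTM.haltsIn_clocked 0 1 y hM, fun γ hγ => ?_, fun o s => ?_⟩
    · obtain ⟨c, -, hc⟩ := QTM.reach_clocked_end 0 1 y (hγ.reach _)
      rw [hn] at hc
      rw [hc]
      exact ⟨QTM.clockEnd_head 0 1 y c, QTM.clockEnd_tape_inr 0 1 y c (.inl (by decide))⟩
    · exact QTM.acceptProb_clocked 0 1 y hM (by rw [hn]; exact hT x) o s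
  · rintro ⟨z, hz⟩
    let one : (QTM.clockAlphabet M.Q z).NonBlank := ⟨none, (Option.some_ne_none _).symm⟩
    -- The blank is the final state of `M`, and the clock tape is also the register.
    refine ⟨QTM.clockAlphabets M (Fin 1) z, one, M.clocked z 0 0, QTM.stateEmbedding M z 0 0,
      hM.clocked _ _ _, QTM.synchronous_clocked _ _, ⟨_, rfl⟩, fun q hq => ?_, fun x => ?_⟩
    · rw [hz] at hq
      exact Prod.ext hq (if_pos hq)
    have hn := QTM.clockTime_clockInput (M := M) (m := 0) one rfl x (T x)
    set y := QTM.clockInput (B := QTM.clockAlphabets M (Fin 1) z) one x (T x)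
    have hT' : M.HaltsIn (QTM.leftInput y) (QTM.clockTime 0 y) := by rw [hn]; exact hT x
    refine ⟨hn ▸ QTM.haltsIn_clocked 0 0 y hM, fun γ hγ => ?_,
      fun o s => QTM.acceptProb_clocked 0 0 y hM hT' o s,
      QTM.finalSuperposition_clocked_eq_idle hM hz 0 0 y hT'⟩
    obtain ⟨c, hr, hc⟩ := QTM.reach_clocked_end 0 0 y (hγ.reach _)
    -- Every configuration of `M` reached at time `T x` is in state `z`, so the exchange leaves the
    -- clock tape intact.
    have hcz : c.state ∈ M.final := hT'.isFinal_of_reach hM hr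
    rw [hz] at hcz
    rw [hn] at hc
    rw [hc]
    exact ⟨QTM.clockEnd_head 0 0 y c 0, QTM.clockEnd_tape_inr 0 0 y c (.inr hcz)⟩
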